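/- Let $m\ge 1$ be an integer, let $\Omega>0$, and let $X_1,\dots,X_{2m}$ be independent real Gaussian processes indexed by $t\in\mathbb R$ on a common probability space. Assume that $X_p(t)\sim\mathcal N\bigl(0,\tfrac{\Omega}{2m}\bigr)$ and $\mathbb E[X_p(t)X_p(t+\tau)]=\tfrac{\Omega}{2m}\,\rho_J(\tau)$ for all $p$ and all $t,\tau\in\mathbb R$, with some function $\rho_J:\mathbb R\to\mathbb R$. Put $Z(t)=\sqrt{\sum_{p=1}^{2m}X_p(t)^2}$. Then: 1. for every $t$, $Z(t)$ has the Nakagami-$m$ distribution with density $\frac{2m^m}{\Gamma(m)\Omega^m}\,x^{2m-1}e^{-mx^2/\Omega}$ on $x>0$; 2. for all $t,\tau\in\mathbb R$ the product $Z(t)Z(t+\tau)$ is integrable, and the autocorrelation $R_Z(\tau)=\mathbb E[Z(t)Z(t+\tau)]$ does not depend on $t$ and equals $$R_Z(\tau)=\Omega\,\rho_Z(\tau),\qquad \rho_Z(\tau)=\frac1m\left(\frac{\Gamma(m+\frac12)}{\Gamma(m)}\right)^2{}_2F_1\!\left(-\tfrac12,-\tfrac12;m;\rho_J(\tau)^2\right),$$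 where ${}_2F_1$ is the Gaussian hypergeometric function. In particular, this holds for the Jakes correlation $\rho_J(\tau)=J_0(2\pi f\tau)$ with Doppler frequency $f\in\mathbb R$, where $J_0$ is the Bessel function of the first kind of order zero. -/

import Mathlib

open MeasureTheory ProbabilityTheory

noncomputable section

/-- The density of the Nakagami distribution with shape `m` and spread (mean power) `Ω`. -/
def nakagamiPDFReal (m Ω x : ℝ) : ℝ :=
  if 0 < x then
    2 * m ^ m / (Real.Gamma m * Ω ^ m) * x ^ (2 * m - 1) * Real.exp (-(m / Ω) * x ^ 2)
  else 0

/-- The Nakagami distribution with shape `m` and spread `Ω`, as a measure on `ℝ`. -/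
def nakagamiMeasure (m Ω : ℝ) : Measure ℝ :=
  volume.withDensity fun x => ENNReal.ofReal (nakagamiPDFReal m Ω x)

/-- The Bessel function of the first kind of order zero,
`J₀(x) = ∑ₖ (-1)ᵏ / (k!)² (x / 2)²ᵏ`. -/
def besselJZero (x : ℝ) : ℝ :=
  ∑' k : ℕ, (-1) ^ k / (k.factorial : ℝ) ^ 2 * (x / 2) ^ (2 * k)

/-- The correlation coefficient of the Clarke-Jakes model with maximum Doppler frequency `f`. -/
def jakesCorrelation (f τ : ℝ) : ℝ := besselJZero (2 * Real.pi * f * τ)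

/-- `X` consists of `2m` independent real Gaussian processes, indexed by time `t : ℝ`, each with
marginals `N(0, Ω / (2m))` and with `E[X_p(t) X_p(t + τ)] = Ω / (2m) * ρ(τ)`. The second field
is independence of the processes as random elements of `ℝ → ℝ` with the product σ-algebra. -/
structure IsGaussianFamily {S : Type*} [MeasurableSpace S] (P : Measure S) (m : ℕ) (Ω : ℝ)
    (ρ : ℝ → ℝ) (X : Fin (2 * m) → ℝ → S → ℝ) : Prop where
  gaussian : ∀ p, IsGaussianProcess (X p) P
  indep : iIndepFun (fun p ω t => X p t ω) P
  law : ∀ p t, HasLaw (X p t) (gaussianReal 0 (Ω / (2 * m)).toNNReal) P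
  correlation : ∀ p t τ, ∫ ω, X p t ω * X p (t + τ) ω ∂P = Ω / (2 * m) * ρ τ

/-- The process `Z(t) = √(∑ₚ X_p(t)²)`. -/
def rootSumSq {S : Type*} {n : ℕ} (X : Fin n → ℝ → S → ℝ) (t : ℝ) (ω : S) : ℝ :=
  √(∑ p, X p t ω ^ 2)

/-- The autocorrelation `E[Z(t) Z(t + τ)]` at time `t` and lag `τ`. -/
def autocorrelation {S : Type*} [MeasurableSpace S] (P : Measure S) (Z : ℝ → S → ℝ)
    (t τ : ℝ) : ℝ :=
  ∫ ω, Z t ω * Z (t + τ) ω ∂P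

/-- The correlation coefficient
`ρ_Z = (1 / m) (Γ(m + 1/2) / Γ(m))² ₂F₁(-1/2, -1/2; m; r²)`, where `r` is the correlation
coefficient of the underlying Gaussian processes. -/
def nakagamiCorrelation (m : ℕ) (r : ℝ) : ℝ :=
  1 / (m : ℝ) * (Real.Gamma (m + 1 / 2) / Real.Gamma m) ^ 2 *
    ordinaryHypergeometric (-1 / 2 : ℝ) (-1 / 2) (m : ℝ) (r ^ 2)

end

/-! For fixed t the vector of the X_p(t) has an isotropic Gaussian density on ℝ^(2m), so polar
coordinates give the law of its norm; this is `map_sqrt_sum_sq_pi_gaussianReal`.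

For the autocorrelation put S = Z(t)², T = Z(t+τ)², κ = Ω/m, q = ρ(τ)². Splitting each pair (X_p(t),
X_p(t+τ)) into a value and an independent regression residual gives its Laplace transform. The
product over the 2m independent pairs is E[e^(-aS-bT)] = ((1+κa)(1+κb) - κ²abq)^(-m)
(`IsGaussianFamily.isKibble`).

Square roots are reached through 2√π √x = ∫₀^∞ (1 - e^(-xt)) t^(-3/2) dt: 4π E[√S √T] is the double
integral of E[(1 - e^(-aS))(1 - e^(-bT))] (ab)^(-3/2). The negative binomial series in q turns this
expectation into a sum of nonnegative terms, each a function of a times the same function of b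
(`hasSum_laplaceFactor_mul`). Tonelli leaves squares of one-dimensional Gamma-type integrals, and
their values are the coefficients of ₂F₁(-1/2, -1/2; m; q). -/

/-! ### Laplace transforms of squared Gaussians -/

/-- The Laplace transform of the square of a real Gaussian random variable. -/
lemma integral_exp_neg_mul_sq_gaussianReal (c : ℝ) (v : NNReal) {b : ℝ} (hb : 0 ≤ b) :
    ∫ x, Real.exp (-b * x ^ 2) ∂(gaussianReal c v) =
      (√(1 + 2 * b * v))⁻¹ * Real.exp (-(b / (1 + 2 * b * v)) * c ^ 2) := by
  -- Zero variance is needed later: the regression residual is degenerate when r² = 1.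
  rcases eq_or_ne v 0 with rfl | hv
  · simp [gaussianReal_zero_var]
  have hv' : (0 : ℝ) < v := by positivity
  have hd : 0 < 1 + 2 * b * v := by positivity
  rw [integral_gaussianReal_eq_integral_smul hv]
  -- Complete the square in the exponent; the new centre is c / (1 + 2bv).
  have key : ∀ x : ℝ, gaussianPDFReal c v x • Real.exp (-b * x ^ 2) =
      ((√(2 * Real.pi * v))⁻¹ * Real.exp (-(b / (1 + 2 * b * v)) * c ^ 2)) *
        Real.exp (-((1 + 2 * b * v) / (2 * v)) * (x - c / (1 + 2 * b * v)) ^ 2) := by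
    intro x
    rw [gaussianPDFReal, smul_eq_mul, mul_assoc (√_)⁻¹, mul_assoc (√_)⁻¹, ← Real.exp_add,
      ← Real.exp_add]
    congr 2
    field_simp
    ring
  simp_rw [key]
  rw [integral_const_mul, integral_sub_right_eq_self
    (fun x => Real.exp (-((1 + 2 * b * v) / (2 * v)) * x ^ 2)), integral_gaussian,
    mul_right_comm, ← Real.sqrt_inv, ← Real.sqrt_mul (by positivity), ← Real.sqrt_inv]
  congr 2
  field_simp

section GaussianPair

variable {S : Type*} [MeasurableSpace S] {P : Measure S}

/-- V - rU is the residual of the linear regression of V on U. For a Gaussian pair, zero covariance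
makes it independent of U; nonnegativity of its variance also yields r² ≤ 1. -/
lemma variance_sub_mul_of_correlation [IsProbabilityMeasure P] {U V : S → ℝ} {v : NNReal} {r : ℝ}
    (hUV : HasGaussianLaw (fun ω => (U ω, V ω)) P)
    (hU : HasLaw U (gaussianReal 0 v) P) (hV : HasLaw V (gaussianReal 0 v) P)
    (hr : ∫ ω, U ω * V ω ∂P = v * r) :
    cov[U, fun ω => V ω - r * U ω; P] = 0 ∧
      Var[fun ω => V ω - r * U ω; P] = v * (1 - r ^ 2) := by
  have hU2 : MemLp U 2 P := hUV.fst.memLp_two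
  have hV2 : MemLp V 2 P := hUV.snd.memLp_two
  have eU : P[U] = 0 := by rw [hU.integral_eq, integral_id_gaussianReal]
  have eV : P[V] = 0 := by rw [hV.integral_eq, integral_id_gaussianReal]
  have vU : Var[U; P] = v := by rw [hU.variance_eq, variance_id_gaussianReal]
  have vV : Var[V; P] = v := by rw [hV.variance_eq, variance_id_gaussianReal]
  have cUV : cov[U, V; P] = v * r := by
    rw [covariance_eq_sub hU2 hV2, eU, eV, ← hr]; simp
  constructor
  · rw [covariance_fun_sub_right hU2 hV2 (hU2.const_mul r), covariance_const_mul_right, cUV,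
      covariance_self hU2.aemeasurable, vU]
    ring
  · rw [variance_fun_sub hV2 (hU2.const_mul r), variance_const_mul, covariance_const_mul_right,
      covariance_comm, cUV, vU, vV]
    ring

/-- Joint Laplace transform of the squares of a centred bivariate Gaussian pair with equal
variances. -/
lemma integral_exp_neg_mul_sq_of_hasGaussianLaw [IsProbabilityMeasure P] {U V : S → ℝ} {v : NNReal}
    {r : ℝ} (hUV : HasGaussianLaw (fun ω => (U ω, V ω)) P)
    (hU : HasLaw U (gaussianReal 0 v) P) (hV : HasLaw V (gaussianReal 0 v) P)
    (hr : ∫ ω, U ω * V ω ∂P = v * r) (hr1 : r ^ 2 ≤ 1) {a b : ℝ} (ha : 0 ≤ a) (hb : 0 ≤ b) :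
    ∫ ω, Real.exp (-a * U ω ^ 2) * Real.exp (-b * V ω ^ 2) ∂P =
      (√((1 + 2 * a * v) * (1 + 2 * b * v) - 4 * a * b * v ^ 2 * r ^ 2))⁻¹ := by
  obtain ⟨hc, hvar⟩ := variance_sub_mul_of_correlation hUV hU hV hr
  set W : S → ℝ := fun ω => V ω - r * U ω with hW
  have hUW : HasGaussianLaw (fun ω => (U ω, W ω)) P :=
    hUV.map_fun ((ContinuousLinearMap.fst ℝ ℝ ℝ).prod
      (ContinuousLinearMap.snd ℝ ℝ ℝ - r • ContinuousLinearMap.fst ℝ ℝ ℝ))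
  have hind : IndepFun U W P := hUW.indepFun_of_covariance_eq_zero hc
  have hW0 : P[W] = 0 := by
    rw [hW, integral_sub hUV.snd.integrable (hUV.fst.integrable.const_mul r), integral_const_mul,
      hU.integral_eq, hV.integral_eq, integral_id_gaussianReal]
    simp
  have hWlaw : P.map W = gaussianReal 0 (v * (1 - r ^ 2)).toNNReal := by
    rw [hUW.snd.map_eq_gaussianReal, hW0, hvar]
  have hw : (((v * (1 - r ^ 2)).toNNReal : NNReal) : ℝ) = v * (1 - r ^ 2) :=
    Real.coe_toNNReal _ (mul_nonneg v.2 (by linarith))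
  set w := (v * (1 - r ^ 2)).toNNReal
  have hmap : P.map (fun ω => (U ω, W ω)) = (gaussianReal 0 v).prod (gaussianReal 0 w) := by
    rw [(indepFun_iff_map_prod_eq_prod_map_map hU.aemeasurable hUW.snd.aemeasurable).1 hind,
      hWlaw, hU.map_eq]
  have hm : Measurable fun p : ℝ × ℝ =>
      Real.exp (-a * p.1 ^ 2) * Real.exp (-b * (r * p.1 + p.2) ^ 2) := by fun_prop
  have hd : 0 < 1 + 2 * b * w := by positivity
  calc _ = ∫ ω, (fun p : ℝ × ℝ => Real.exp (-a * p.1 ^ 2) * Real.exp (-b * (r * p.1 + p.2) ^ 2))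
          (U ω, W ω) ∂P := by simp [hW]
    _ = ∫ p, Real.exp (-a * p.1 ^ 2) * Real.exp (-b * (r * p.1 + p.2) ^ 2)
          ∂((gaussianReal 0 v).prod (gaussianReal 0 w)) := by
        rw [← hmap, integral_map hUW.aemeasurable hm.aestronglyMeasurable]
    _ = ∫ x, ∫ y, Real.exp (-a * x ^ 2) * Real.exp (-b * (r * x + y) ^ 2)
          ∂(gaussianReal 0 w) ∂(gaussianReal 0 v) := by
        refine integral_prod _ (Integrable.of_bound hm.aestronglyMeasurable 1 (ae_of_all _ ?_))
        intro p
        rw [Real.norm_of_nonneg (by positivity), ← Real.exp_add, Real.exp_le_one_iff]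
        nlinarith [sq_nonneg p.1, sq_nonneg (r * p.1 + p.2), mul_nonneg ha (sq_nonneg p.1),
          mul_nonneg hb (sq_nonneg (r * p.1 + p.2))]
    _ = ∫ x, (√(1 + 2 * b * w))⁻¹ * Real.exp (-(a + b * r ^ 2 / (1 + 2 * b * w)) * x ^ 2)
          ∂(gaussianReal 0 v) := by
        congr 1
        ext x
        -- Given U = x, the variable V is Gaussian with mean rx, so the noncentral Laplace transform
        -- applies.
        have : ∫ y, Real.exp (-b * (r * x + y) ^ 2) ∂(gaussianReal 0 w) =
            ∫ y, Real.exp (-b * y ^ 2) ∂(gaussianReal (r * x) w) := by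
          have h := gaussianReal_map_const_add (μ := 0) (v := w) (r * x)
          rw [zero_add] at h
          rw [← h, integral_map (by fun_prop) (by fun_prop)]
        rw [integral_const_mul, this, integral_exp_neg_mul_sq_gaussianReal _ _ hb, mul_left_comm,
          ← Real.exp_add]
        congr 2
        ring
    _ = _ := by
        rw [integral_const_mul, integral_exp_neg_mul_sq_gaussianReal _ _ (by positivity),
          ← mul_assoc, ← mul_inv, ← Real.sqrt_mul hd.le]
        simp only [ne_eq, OfNat.ofNat_ne_zero, not_false_eq_true, zero_pow, mul_zero, Real.exp_zero,
          mul_one]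
        congr 2
        field_simp
        rw [hw]
        ring

end GaussianPair

/-! ### The Nakagami law of the norm -/

lemma pi_gaussianReal_eq_withDensity (n : ℕ) (c : ℝ) {v : NNReal} (hv : v ≠ 0) :
    Measure.pi (fun _ : Fin n => gaussianReal c v) =
      (volume : Measure (Fin n → ℝ)).withDensity
        fun x => ENNReal.ofReal (∏ i, gaussianPDFReal c v (x i)) := by
  refine Measure.pi_eq fun s hs => ?_
  rw [withDensity_apply _ (MeasurableSet.univ_pi hs), volume_pi, Measure.restrict_pi_pi,
    ← ofReal_integral_eq_lintegral_ofReal, integral_fintype_prod_eq_prod,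
    ENNReal.ofReal_prod_of_nonneg]
  · simp_rw [gaussianReal_apply_eq_integral c hv]
  · exact fun i _ => integral_nonneg fun x => gaussianPDFReal_nonneg c v x
  · exact Integrable.fintype_prod fun i => (integrable_gaussianPDFReal c v).restrict
  · exact ae_of_all _ fun x => Finset.prod_nonneg fun i _ => gaussianPDFReal_nonneg c v _

lemma prod_gaussianPDFReal_zero (n : ℕ) (v : NNReal) (x : Fin n → ℝ) :
    ∏ i, gaussianPDFReal 0 v (x i) =
      (√(2 * Real.pi * v))⁻¹ ^ n * Real.exp (-(√(∑ i, x i ^ 2)) ^ 2 / (2 * v)) := by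
  simp only [gaussianPDFReal, sub_zero]
  rw [Finset.prod_mul_distrib, Finset.prod_const, Finset.card_univ, Fintype.card_fin,
    ← Real.exp_sum, Real.sq_sqrt (by positivity), ← Finset.sum_div, Finset.sum_neg_distrib]

/-- Polar coordinates for the image of a rotation invariant integral under the norm. -/
lemma lintegral_fun_norm_addHaar {E : Type*} [NormedAddCommGroup E] [NormedSpace ℝ E]
    [MeasurableSpace E] [BorelSpace E] [FiniteDimensional ℝ E] [Nontrivial E] (μ : Measure E)
    [μ.IsAddHaarMeasure] {f : ℝ → ℝ} (hf : Integrable (fun x => f ‖x‖) μ) (h0 : ∀ x, 0 ≤ f x) :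
    ∫⁻ x, ENNReal.ofReal (f ‖x‖) ∂μ =
      ∫⁻ y in Set.Ioi (0 : ℝ), ENNReal.ofReal
        (Module.finrank ℝ E * μ.real (Metric.ball 0 1) * y ^ (Module.finrank ℝ E - 1) * f y) := by
  have hi := (integrable_fun_norm_addHaar μ).1 hf
  rw [← ofReal_integral_eq_lintegral_ofReal hf (ae_of_all _ fun x => h0 _),
    integral_fun_norm_addHaar, ← ofReal_integral_eq_lintegral_ofReal]
  · simp only [smul_eq_mul, nsmul_eq_mul, mul_assoc]
    rw [integral_const_mul, integral_const_mul]
  · simpa only [smul_eq_mul, mul_assoc] using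
      (hi.const_mul (μ.real (Metric.ball 0 1))).const_mul (Module.finrank ℝ E : ℝ)
  · refine (ae_restrict_iff' measurableSet_Ioi).2 (ae_of_all _ fun y hy => ?_)
    have := h0 y
    have : 0 < y := hy
    positivity

/-- The right side is what polar coordinates produce: sphere area 2m · π^m/m! · y^(2m-1) times the
Gaussian density at radius y. -/
lemma nakagamiPDFReal_natCast {m : ℕ} (hm : 1 ≤ m) {Ω : ℝ} (hΩ : 0 < Ω) {y : ℝ} (hy : 0 < y) :
    nakagamiPDFReal m Ω y = (2 * m : ℕ) * (Real.pi ^ m / m.factorial) * y ^ (2 * m - 1) *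
      ((√(2 * Real.pi * (Ω / (2 * m))))⁻¹ ^ (2 * m) * Real.exp (-y ^ 2 / (2 * (Ω / (2 * m))))) := by
  have hm' : (0 : ℝ) < m := by exact_mod_cast hm
  obtain ⟨k, rfl⟩ : ∃ k, m = k + 1 := ⟨m - 1, by omega⟩
  have e1 : (2 * ((k + 1 : ℕ) : ℝ) - 1) = ((2 * (k + 1) - 1 : ℕ) : ℝ) := by
    rw [Nat.cast_sub (by omega)]; push_cast; ring
  rw [nakagamiPDFReal, if_pos hy, e1, Real.rpow_natCast, Real.rpow_natCast, Real.rpow_natCast,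
    pow_mul _ 2, inv_pow, Real.sq_sqrt (by positivity), Nat.cast_succ, Real.Gamma_nat_eq_factorial,
    Nat.factorial_succ]
  have e2 : -((k + 1 : ℝ) / Ω) * y ^ 2 = -y ^ 2 / (2 * (Ω / (2 * (k + 1)))) := by
    field_simp
  have e3 : (2 * Real.pi * (Ω / (2 * (k + 1 : ℝ)))) = Real.pi * Ω / (k + 1) := by field_simp
  rw [e2, e3, inv_pow, div_pow, mul_pow]
  push_cast
  have := Real.pi_pos
  field_simp

/-- The Euclidean norm of `2m` independent centred Gaussians is Nakagami distributed. -/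
lemma map_sqrt_sum_sq_pi_gaussianReal {m : ℕ} (hm : 1 ≤ m) {Ω : ℝ} (hΩ : 0 < Ω) :
    (Measure.pi fun _ : Fin (2 * m) => gaussianReal 0 (Ω / (2 * m)).toNNReal).map
      (fun x => √(∑ i, x i ^ 2)) = nakagamiMeasure m Ω := by
  have hm' : (0 : ℝ) < m := by exact_mod_cast hm
  have hv : (Ω / (2 * m)).toNNReal ≠ 0 := by
    simpa using (by positivity : 0 < Ω / (2 * m))
  have hv' : ((Ω / (2 * m)).toNNReal : ℝ) = Ω / (2 * m) := Real.coe_toNNReal _ (by positivity)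
  have : Nonempty (Fin (2 * m)) := ⟨⟨0, by omega⟩⟩
  have hmeas : Measurable fun x : Fin (2 * m) → ℝ => √(∑ i, x i ^ 2) := by fun_prop
  ext s hs
  set g : ℝ → ℝ := fun y => (√(2 * Real.pi * (Ω / (2 * m))))⁻¹ ^ (2 * m) *
    Real.exp (-y ^ 2 / (2 * (Ω / (2 * m)))) with hg
  have hg0 : ∀ y, 0 ≤ g y := fun y => by positivity
  have hgm : Measurable g := by fun_prop
  have hfm : Measurable (s.indicator g) := hgm.indicator hs
  have hf0 : ∀ y, 0 ≤ s.indicator g y := fun y => Set.indicator_nonneg (fun x _ => hg0 x) y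
  -- Polar coordinates need the Euclidean norm, whereas `Fin (2 * m) → ℝ` carries the sup norm;
  -- hence the passage to `EuclideanSpace`.
  have hpi : (Measure.pi fun _ : Fin (2 * m) => gaussianReal 0 (Ω / (2 * m)).toNNReal).map
      (fun x => √(∑ i, x i ^ 2)) s =
        ∫⁻ x : EuclideanSpace ℝ (Fin (2 * m)), ENNReal.ofReal (s.indicator g ‖x‖) := by
    rw [Measure.map_apply hmeas hs, pi_gaussianReal_eq_withDensity _ _ hv,
      withDensity_apply _ (hmeas hs), ← lintegral_indicator (hmeas hs),
      ← (PiLp.volume_preserving_ofLp (Fin (2 * m))).lintegral_comp]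
    · congr 1
      ext x
      have hn : ‖x‖ = √(∑ i, x.ofLp i ^ 2) := by simp [EuclideanSpace.norm_eq]
      by_cases h : √(∑ i, x.ofLp i ^ 2) ∈ s <;>
        simp [Set.indicator, hn, h, prod_gaussianPDFReal_zero, hv', hg]
    · refine Measurable.indicator ?_ (hmeas hs)
      simp_rw [prod_gaussianPDFReal_zero]
      fun_prop
  have hint : Integrable (fun x : EuclideanSpace ℝ (Fin (2 * m)) => s.indicator g ‖x‖) := by
    refine ⟨(hfm.comp measurable_norm).aestronglyMeasurable, ?_⟩
    -- By `hpi` the integral is a probability, hence finite.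
    rw [hasFiniteIntegral_iff_ofReal (ae_of_all _ fun x => hf0 _), ← hpi]
    exact measure_lt_top _ _
  have : Nontrivial (EuclideanSpace ℝ (Fin (2 * m))) := by
    apply Module.nontrivial_of_finrank_pos (R := ℝ)
    simp only [finrank_euclideanSpace, Fintype.card_fin]
    omega
  rw [hpi, lintegral_fun_norm_addHaar _ hint hf0, nakagamiMeasure, withDensity_apply _ hs,
    ← lintegral_indicator hs, ← lintegral_indicator measurableSet_Ioi]
  congr 1
  ext y
  have hball : (volume : Measure (EuclideanSpace ℝ (Fin (2 * m)))).real (Metric.ball 0 1) =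
      Real.pi ^ m / m.factorial := by
    rw [Measure.real, InnerProductSpace.volume_ball_of_dim_even (k := m) (by simp)]
    simp only [ENNReal.ofReal_one, one_pow, one_mul]
    exact ENNReal.toReal_ofReal (by positivity)
  rw [hball, finrank_euclideanSpace, Fintype.card_fin]
  by_cases hy : 0 < y
  · by_cases hys : y ∈ s
    · rw [Set.indicator_of_mem (Set.mem_Ioi.2 hy), Set.indicator_of_mem hys,
        Set.indicator_of_mem hys, nakagamiPDFReal_natCast hm hΩ hy]
    · simp [hys]
  · rw [Set.indicator_of_notMem (by simpa using hy)]
    simp [Set.indicator, nakagamiPDFReal, hy]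

theorem hasLaw_rootSumSq {S : Type*} [MeasurableSpace S] {P : Measure S} [IsProbabilityMeasure P]
    {m : ℕ} (hm : 1 ≤ m) {Ω : ℝ} (hΩ : 0 < Ω) {ρ : ℝ → ℝ} {X : Fin (2 * m) → ℝ → S → ℝ}
    (hX : IsGaussianFamily P m Ω ρ X) (t : ℝ) :
    HasLaw (rootSumSq X t) (nakagamiMeasure m Ω) P := by
  have hi : iIndepFun (fun p ω => X p t ω) P :=
    hX.indep.comp (fun _ x => x t) fun _ => measurable_pi_apply t
  have hm : ∀ p, AEMeasurable (X p t) P := fun p => (hX.law p t).aemeasurable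
  have hmeas : Measurable fun x : Fin (2 * m) → ℝ => √(∑ i, x i ^ 2) := by fun_prop
  have hpi : AEMeasurable (fun ω p => X p t ω) P := aemeasurable_pi_lambda _ hm
  refine ⟨hmeas.comp_aemeasurable hpi, ?_⟩
  rw [← map_sqrt_sum_sq_pi_gaussianReal ‹_› hΩ]
  have := hi.map_fun_eq_pi_map hm
  simp_rw [(hX.law _ t).map_eq] at this
  rw [← this, AEMeasurable.map_map_of_aemeasurable hmeas.aemeasurable hpi]
  rfl

/-! ### Square roots as exponential mixtures, and half-line integrals -/

lemma lintegral_rpow_mul_exp_neg_mul_Ioi {s r : ℝ} (hs : 0 < s) (hr : 0 < r) :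
    ∫⁻ t in Set.Ioi (0 : ℝ), ENNReal.ofReal (t ^ (s - 1) * Real.exp (-(r * t))) =
      ENNReal.ofReal ((1 / r) ^ s * Real.Gamma s) := by
  have h := Real.integral_rpow_mul_exp_neg_mul_Ioi hs hr
  have := Real.Gamma_pos_of_pos hs
  rw [← h, ofReal_integral_eq_lintegral_ofReal]
  · exact Integrable.of_integral_ne_zero (by rw [h]; positivity)
  · refine (ae_restrict_iff' measurableSet_Ioi).2 (ae_of_all _ fun y (hy : 0 < y) => ?_)
    positivity

lemma lintegral_rpow_neg_half_Ioc {x : ℝ} (hx : 0 ≤ x) :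
    ∫⁻ u in Set.Ioc 0 x, ENNReal.ofReal (u ^ (-(1 / 2) : ℝ)) = ENNReal.ofReal (2 * √x) := by
  have h1 : (-1 : ℝ) < -(1 / 2) := by norm_num
  rw [← ofReal_integral_eq_lintegral_ofReal, ← intervalIntegral.integral_of_le hx,
    integral_rpow (Or.inl h1), Real.sqrt_eq_rpow, Real.zero_rpow (by norm_num)]
  · congr 1
    norm_num
    ring
  · exact (intervalIntegrable_iff_integrableOn_Ioc_of_le hx).1
      (intervalIntegral.intervalIntegrable_rpow' h1)
  · refine (ae_restrict_iff' measurableSet_Ioc).2 (ae_of_all _ fun y hy => ?_)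
    exact Real.rpow_nonneg hy.1.le _

lemma lintegral_mul_exp_neg_mul_Ioc {x t : ℝ} (hx : 0 ≤ x) (ht : 0 < t) :
    ∫⁻ u in Set.Ioc 0 x, ENNReal.ofReal (t * Real.exp (-(u * t))) =
      ENNReal.ofReal (1 - Real.exp (-(x * t))) := by
  have hd : ∀ u ∈ Set.uIcc 0 x,
      HasDerivAt (fun u => -Real.exp (-(u * t))) (t * Real.exp (-(u * t))) u := by
    intro u _
    have h : HasDerivAt (fun u => -Real.exp (-(u * t))) (-(Real.exp (-(u * t)) * -(1 * t))) u :=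
      (((hasDerivAt_id u).mul_const t).fun_neg.exp).fun_neg
    exact h.congr_deriv (by ring)
  have hc : Continuous fun u => t * Real.exp (-(u * t)) := by fun_prop
  rw [← ofReal_integral_eq_lintegral_ofReal, ← intervalIntegral.integral_of_le hx,
    intervalIntegral.integral_eq_sub_of_hasDerivAt hd (hc.intervalIntegrable _ _)]
  · congr 1
    simp
    ring
  · exact (intervalIntegrable_iff_integrableOn_Ioc_of_le hx).1 (hc.intervalIntegrable _ _)
  · exact ae_of_all _ fun u => by positivity

/-- The Lévy representation of the square root as a mixture of `1 - e^{-x t}`. -/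
lemma lintegral_one_sub_exp_mul_rpow {x : ℝ} (hx : 0 ≤ x) :
    ∫⁻ t in Set.Ioi (0 : ℝ), ENNReal.ofReal ((1 - Real.exp (-(x * t))) * t ^ (-(3 / 2) : ℝ)) =
      ENNReal.ofReal (2 * √Real.pi * √x) := by
  -- Write 1 - e^(-xt) as ∫₀^x t e^(-ut) du and exchange; the t-integral is then Γ(1/2) u^(-1/2).
  calc _ = ∫⁻ t in Set.Ioi (0 : ℝ), ∫⁻ u in Set.Ioc 0 x,
        ENNReal.ofReal (t ^ ((1 / 2 : ℝ) - 1) * Real.exp (-(u * t))) := by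
        refine setLIntegral_congr_fun measurableSet_Ioi fun t (ht : 0 < t) => ?_
        have h1 : 0 ≤ 1 - Real.exp (-(x * t)) := by
          rw [sub_nonneg, Real.exp_le_one_iff]
          nlinarith
        rw [ENNReal.ofReal_mul h1, ← lintegral_mul_exp_neg_mul_Ioc hx ht,
          ← lintegral_mul_const _ (by fun_prop)]
        congr 1
        ext u
        rw [← ENNReal.ofReal_mul (by positivity), mul_right_comm, ← Real.rpow_one_add' ht.le
          (by norm_num)]
        norm_num
    _ = ∫⁻ u in Set.Ioc 0 x, ∫⁻ t in Set.Ioi (0 : ℝ),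
        ENNReal.ofReal (t ^ ((1 / 2 : ℝ) - 1) * Real.exp (-(u * t))) :=
      lintegral_lintegral_swap (by fun_prop)
    _ = ∫⁻ u in Set.Ioc 0 x, ENNReal.ofReal (√Real.pi) * ENNReal.ofReal (u ^ (-(1 / 2) : ℝ)) := by
        refine setLIntegral_congr_fun measurableSet_Ioc fun u hu => ?_
        rw [lintegral_rpow_mul_exp_neg_mul_Ioi (by norm_num) hu.1, Real.Gamma_one_half_eq,
          ENNReal.ofReal_mul (by have := hu.1; positivity), mul_comm, one_div,
          Real.inv_rpow hu.1.le, Real.rpow_neg hu.1.le]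
    _ = _ := by
        rw [lintegral_const_mul _ (by fun_prop), lintegral_rpow_neg_half_Ioc hx,
          ← ENNReal.ofReal_mul (by positivity)]
        congr 1
        ring

/-- A beta integral over the half line, obtained from Gamma integrals. -/
lemma lintegral_pow_div_one_add_pow_mul_rpow {m k : ℕ} (hk : 1 ≤ k) {κ : ℝ} (hκ : 0 < κ) :
    ∫⁻ u in Set.Ioi (0 : ℝ),
        ENNReal.ofReal ((κ * u) ^ k / (1 + κ * u) ^ (m + k) * u ^ (-(3 / 2) : ℝ)) =
      ENNReal.ofReal
        (√κ * Real.Gamma (k - 1 / 2) * Real.Gamma (m + 1 / 2) / Real.Gamma (m + k)) := by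
  have hk' : (1 : ℝ) ≤ k := by exact_mod_cast hk
  have hm' : (0 : ℝ) ≤ m := by positivity
  have g1 : 0 < Real.Gamma (m + k) := Real.Gamma_pos_of_pos (by linarith)
  have g2 : 0 < Real.Gamma (k - 1 / 2) := Real.Gamma_pos_of_pos (by linarith)
  -- Write (1+κu)^(-(m+k)) as a Gamma integral in x and exchange. The u-integral gives Γ(k-1/2),
  -- convergent since k ≥ 1, and the x-integral gives Γ(m+1/2).
  calc _ = ∫⁻ u in Set.Ioi (0 : ℝ), ∫⁻ x in Set.Ioi (0 : ℝ), ENNReal.ofReal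
        ((κ * u) ^ k * u ^ (-(3 / 2) : ℝ) / Real.Gamma (m + k) *
          (x ^ ((m + k : ℝ) - 1) * Real.exp (-((1 + κ * u) * x)))) := by
        refine setLIntegral_congr_fun measurableSet_Ioi fun u (hu : 0 < u) => ?_
        have hc : 0 ≤ (κ * u) ^ k * u ^ (-(3 / 2) : ℝ) / Real.Gamma (m + k) := by positivity
        simp_rw [ENNReal.ofReal_mul hc]
        rw [lintegral_const_mul _ (by fun_prop),
          lintegral_rpow_mul_exp_neg_mul_Ioi (by linarith) (by positivity),
          ← ENNReal.ofReal_mul hc, ← Nat.cast_add, Real.rpow_natCast]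
        congr 1
        rw [← Nat.cast_add] at g1
        rw [one_div_pow]
        field_simp
    _ = ∫⁻ x in Set.Ioi (0 : ℝ), ∫⁻ u in Set.Ioi (0 : ℝ), ENNReal.ofReal
        ((κ * u) ^ k * u ^ (-(3 / 2) : ℝ) / Real.Gamma (m + k) *
          (x ^ ((m + k : ℝ) - 1) * Real.exp (-((1 + κ * u) * x)))) :=
      lintegral_lintegral_swap (by fun_prop)
    _ = ∫⁻ x in Set.Ioi (0 : ℝ),
        ENNReal.ofReal (√κ * Real.Gamma (k - 1 / 2) / Real.Gamma (m + k)) *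
          ENNReal.ofReal (x ^ ((m + 1 / 2 : ℝ) - 1) * Real.exp (-(1 * x))) := by
        refine setLIntegral_congr_fun measurableSet_Ioi fun x (hx : 0 < x) => ?_
        have hc : 0 ≤ κ ^ k / Real.Gamma (m + k) * (x ^ ((m + k : ℝ) - 1) * Real.exp (-x)) := by
          positivity
        calc _ = ∫⁻ u in Set.Ioi (0 : ℝ), ENNReal.ofReal
              (κ ^ k / Real.Gamma (m + k) * (x ^ ((m + k : ℝ) - 1) * Real.exp (-x))) *
              ENNReal.ofReal (u ^ ((k - 1 / 2 : ℝ) - 1) * Real.exp (-(κ * x * u))) := by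
              refine setLIntegral_congr_fun measurableSet_Ioi fun u (hu : 0 < u) => ?_
              rw [← ENNReal.ofReal_mul hc]
              congr 1
              have e1 : u ^ ((k - 1 / 2 : ℝ) - 1) = u ^ k * u ^ (-(3 / 2) : ℝ) := by
                rw [← Real.rpow_natCast, ← Real.rpow_add hu]
                ring_nf
              have e2 : Real.exp (-((1 + κ * u) * x)) =
                  Real.exp (-x) * Real.exp (-(κ * x * u)) := by
                rw [← Real.exp_add]
                ring_nf
              rw [e1, e2, mul_pow]
              ring
          _ = _ := by
              rw [lintegral_const_mul _ (by fun_prop),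
                lintegral_rpow_mul_exp_neg_mul_Ioi (by linarith) (by positivity),
                ← ENNReal.ofReal_mul hc, ← ENNReal.ofReal_mul (by positivity)]
              congr 1
              have e1 : (1 / (κ * x)) ^ (k - 1 / 2 : ℝ) = √κ / κ ^ k * x ^ (1 / 2 - k : ℝ) := by
                rw [one_div, Real.inv_rpow (by positivity), ← Real.rpow_neg (by positivity),
                  Real.mul_rpow hκ.le hx.le, Real.sqrt_eq_rpow, ← Real.rpow_natCast,
                  ← Real.rpow_sub hκ]
                ring_nf
              have e2 : x ^ ((m + 1 / 2 : ℝ) - 1) =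
                  x ^ ((m + k : ℝ) - 1) * x ^ (1 / 2 - k : ℝ) := by
                rw [← Real.rpow_add hx]
                ring_nf
              rw [e1, e2, one_mul]
              field_simp
    _ = _ := by
        rw [lintegral_const_mul _ (by fun_prop),
          lintegral_rpow_mul_exp_neg_mul_Ioi (by positivity) one_pos,
          ← ENNReal.ofReal_mul (by positivity)]
        congr 1
        simp
        ring

/-- The k = 0 counterpart, where subtraction from 1 restores convergence at 0. Averaging 1 -
e^(-κxu) over a Gamma(m) variable x reduces it to the Lévy representation. -/
lemma lintegral_one_sub_inv_one_add_pow_mul_rpow {m : ℕ} (hm : 1 ≤ m) {κ : ℝ} (hκ : 0 < κ) :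
    ∫⁻ u in Set.Ioi (0 : ℝ),
        ENNReal.ofReal ((1 - 1 / (1 + κ * u) ^ m) * u ^ (-(3 / 2) : ℝ)) =
      ENNReal.ofReal (√κ * (2 * √Real.pi) * Real.Gamma (m + 1 / 2) / Real.Gamma m) := by
  have hm' : (0 : ℝ) < m := by exact_mod_cast hm
  have g1 : 0 < Real.Gamma m := Real.Gamma_pos_of_pos hm'
  calc _ = ∫⁻ u in Set.Ioi (0 : ℝ), ∫⁻ x in Set.Ioi (0 : ℝ), ENNReal.ofReal
        (u ^ (-(3 / 2) : ℝ) / Real.Gamma m *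
          (x ^ ((m : ℝ) - 1) * Real.exp (-x) * (1 - Real.exp (-(κ * x * u))))) := by
        refine setLIntegral_congr_fun measurableSet_Ioi fun u (hu : 0 < u) => ?_
        have hc : 0 ≤ u ^ (-(3 / 2) : ℝ) / Real.Gamma m := by positivity
        have h1 := Real.integral_rpow_mul_exp_neg_mul_Ioi hm' one_pos
        have h2 := Real.integral_rpow_mul_exp_neg_mul_Ioi hm' (r := 1 + κ * u) (by positivity)
        have i1 := Integrable.of_integral_ne_zero (h1.trans_ne (by positivity))
        have i2 := Integrable.of_integral_ne_zero (h2.trans_ne (by positivity))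
        have e : ∀ x : ℝ, x ^ ((m : ℝ) - 1) * Real.exp (-x) * (1 - Real.exp (-(κ * x * u))) =
            x ^ ((m : ℝ) - 1) * Real.exp (-(1 * x)) -
              x ^ ((m : ℝ) - 1) * Real.exp (-((1 + κ * u) * x)) := by
          intro x
          rw [one_mul, mul_sub, mul_one, mul_assoc, ← Real.exp_add]
          ring_nf
        simp_rw [ENNReal.ofReal_mul hc]
        rw [lintegral_const_mul _ (by fun_prop), ← ofReal_integral_eq_lintegral_ofReal,
          ← ENNReal.ofReal_mul hc]
        · simp_rw [e]
          rw [integral_sub i1 i2, h1, h2, Real.rpow_natCast]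
          congr 1
          simp
          field_simp
        · simp_rw [e]
          exact i1.sub i2
        · refine (ae_restrict_iff' measurableSet_Ioi).2 (ae_of_all _ fun x (hx : 0 < x) => ?_)
          have : 0 ≤ 1 - Real.exp (-(κ * x * u)) := by
            rw [sub_nonneg, Real.exp_le_one_iff, neg_nonpos]
            positivity
          positivity
    _ = ∫⁻ x in Set.Ioi (0 : ℝ), ∫⁻ u in Set.Ioi (0 : ℝ), ENNReal.ofReal
        (u ^ (-(3 / 2) : ℝ) / Real.Gamma m *
          (x ^ ((m : ℝ) - 1) * Real.exp (-x) * (1 - Real.exp (-(κ * x * u))))) :=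
      lintegral_lintegral_swap (by fun_prop)
    _ = ∫⁻ x in Set.Ioi (0 : ℝ),
        ENNReal.ofReal (√κ * (2 * √Real.pi) / Real.Gamma m) *
          ENNReal.ofReal (x ^ ((m + 1 / 2 : ℝ) - 1) * Real.exp (-(1 * x))) := by
        refine setLIntegral_congr_fun measurableSet_Ioi fun x (hx : 0 < x) => ?_
        have hc : 0 ≤ x ^ ((m : ℝ) - 1) * Real.exp (-x) / Real.Gamma m := by positivity
        have e : ∀ u : ℝ, u ^ (-(3 / 2) : ℝ) / Real.Gamma m *
            (x ^ ((m : ℝ) - 1) * Real.exp (-x) * (1 - Real.exp (-(κ * x * u)))) =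
            x ^ ((m : ℝ) - 1) * Real.exp (-x) / Real.Gamma m *
              ((1 - Real.exp (-(κ * x * u))) * u ^ (-(3 / 2) : ℝ)) := fun u => by ring
        simp_rw [e, ENNReal.ofReal_mul hc]
        rw [lintegral_const_mul _ (by fun_prop), lintegral_one_sub_exp_mul_rpow (by positivity),
          ← ENNReal.ofReal_mul hc, ← ENNReal.ofReal_mul (by positivity)]
        congr 1
        have e2 : x ^ ((m + 1 / 2 : ℝ) - 1) = x ^ ((m : ℝ) - 1) * √x := by
          rw [Real.sqrt_eq_rpow, ← Real.rpow_add hx]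
          ring_nf
        rw [e2, Real.sqrt_mul hκ.le, one_mul]
        ring
    _ = _ := by
        rw [lintegral_const_mul _ (by fun_prop),
          lintegral_rpow_mul_exp_neg_mul_Ioi (by positivity) one_pos,
          ← ENNReal.ofReal_mul (by positivity)]
        congr 1
        simp
        ring

/-! ### Pochhammer symbols and the expansion in powers of q -/

lemma Gamma_add_natCast_eq_ascPochhammer {x : ℝ} (hx : ∀ j : ℕ, x + j ≠ 0) (k : ℕ) :
    Real.Gamma (x + k) = (ascPochhammer ℝ k).eval x * Real.Gamma x := by
  induction k with
  | zero => simp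
  | succ k ih =>
    rw [Nat.cast_succ, ← add_assoc, Real.Gamma_add_one (hx k), ih, ascPochhammer_succ_eval]
    ring

/-- Γ(-1/2) = -2√π is negative, which is why absolute values of Γ(k-1/2) appear below. -/
lemma Gamma_natCast_sub_half (k : ℕ) :
    Real.Gamma (k - 1 / 2) = -(2 * √Real.pi) * (ascPochhammer ℝ k).eval (-1 / 2 : ℝ) := by
  have hne : ∀ j : ℕ, (-1 / 2 : ℝ) + j ≠ 0 := by
    intro j h
    have : (2 * j : ℝ) = 1 := by linarith
    have : 2 * j = 1 := by exact_mod_cast this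
    omega
  have h0 : Real.Gamma (-1 / 2) = -(2 * √Real.pi) := by
    have := Real.Gamma_add_one (s := -1 / 2) (by norm_num)
    rw [show (-1 / 2 + 1 : ℝ) = 1 / 2 by norm_num, Real.Gamma_one_half_eq] at this
    linarith
  rw [← h0, mul_comm, ← Gamma_add_natCast_eq_ascPochhammer hne]
  ring_nf

lemma choose_eq_ascPochhammer_div {m : ℕ} (hm : 1 ≤ m) (k : ℕ) :
    ((k + (m - 1)).choose (m - 1) : ℝ) = (ascPochhammer ℝ k).eval (m : ℝ) / k.factorial := by
  obtain ⟨n, rfl⟩ : ∃ n, m = n + 1 := ⟨m - 1, by omega⟩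
  rw [← ascPochhammer_eval_cast, ascPochhammer_nat_eq_ascFactorial,
    Nat.ascFactorial_eq_factorial_mul_choose, Nat.cast_mul, mul_div_cancel_left₀ _ (by positivity),
    add_tsub_cancel_right, add_comm k n, Nat.choose_symm_add]

/-- The factors in the expansion of `E[(1 - e^{-aS})(1 - e^{-bT})]` in powers of the squared
correlation coefficient. -/
noncomputable def laplaceFactor (m : ℕ) (κ : ℝ) (k : ℕ) (a : ℝ) : ℝ :=
  if k = 0 then 1 - 1 / (1 + κ * a) ^ m else (κ * a) ^ k / (1 + κ * a) ^ (m + k)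

lemma measurable_laplaceFactor (m : ℕ) (κ : ℝ) (k : ℕ) : Measurable (laplaceFactor m κ k) := by
  unfold laplaceFactor
  split_ifs <;> fun_prop

lemma laplaceFactor_nonneg (m : ℕ) {κ : ℝ} (hκ : 0 < κ) (k : ℕ) {a : ℝ} (ha : 0 ≤ a) :
    0 ≤ laplaceFactor m κ k a := by
  unfold laplaceFactor
  split_ifs
  · rw [sub_nonneg]
    refine div_le_one_of_le₀ (one_le_pow₀ ?_) (by positivity)
    nlinarith
  · positivity

lemma lintegral_laplaceFactor_mul_rpow {m : ℕ} (hm : 1 ≤ m) {κ : ℝ} (hκ : 0 < κ) (k : ℕ) :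
    ∫⁻ a in Set.Ioi (0 : ℝ), ENNReal.ofReal (laplaceFactor m κ k a * a ^ (-(3 / 2) : ℝ)) =
      ENNReal.ofReal (√κ * |Real.Gamma (k - 1 / 2)| * Real.Gamma (m + 1 / 2) /
        Real.Gamma (m + k)) := by
  unfold laplaceFactor
  split_ifs with hk
  · subst hk
    rw [lintegral_one_sub_inv_one_add_pow_mul_rpow hm hκ, Gamma_natCast_sub_half]
    simp [abs_of_nonneg, Real.sqrt_nonneg]
  · have h1 : 1 ≤ k := Nat.one_le_iff_ne_zero.2 hk
    have h2 : (1 : ℝ) ≤ k := by exact_mod_cast h1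
    rw [lintegral_pow_div_one_add_pow_mul_rpow h1 hκ, abs_of_pos]
    exact Real.Gamma_pos_of_pos (by linarith)

/-- Factoring (1+κa)(1+κb) out of the last denominator leaves (1-x)^(-m) with x proportional to q, a
negative binomial series. The other three terms do not involve q and complete the k = 0 term to a
product. -/
lemma hasSum_laplaceFactor_mul {m : ℕ} (hm : 1 ≤ m) {κ q a b : ℝ} (hκ : 0 < κ) (hq0 : 0 ≤ q)
    (hq1 : q ≤ 1) (ha : 0 ≤ a) (hb : 0 ≤ b) :
    HasSum (fun k => ((k + (m - 1)).choose (m - 1) : ℝ) * q ^ k *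
        (laplaceFactor m κ k a * laplaceFactor m κ k b))
      (1 - 1 / (1 + κ * a) ^ m - 1 / (1 + κ * b) ^ m +
        1 / ((1 + κ * a) * (1 + κ * b) - κ * a * (κ * b) * q) ^ m) := by
  have hA : 0 < 1 + κ * a := by positivity
  have hB : 0 < 1 + κ * b := by positivity
  have hab : 0 ≤ κ * a * (κ * b) := by positivity
  -- Strict even at q = 1, so full correlation needs no limiting argument.
  have hlt : κ * a * (κ * b) * q < (1 + κ * a) * (1 + κ * b) := by
    have : 0 ≤ κ * a := by positivity
    have : 0 ≤ κ * b := by positivity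
    nlinarith
  set x := κ * a * (κ * b) * q / ((1 + κ * a) * (1 + κ * b)) with hx
  have hx1 : ‖x‖ < 1 := by
    rw [Real.norm_of_nonneg (by positivity), div_lt_one (by positivity)]
    exact hlt
  -- Only the k = 0 term changes, which `update` records together with the change in the sum.
  have h := ((hasSum_choose_mul_geometric_of_norm_lt_one (m - 1) hx1).mul_left
    (1 / ((1 + κ * a) * (1 + κ * b)) ^ m)).update 0
    ((1 - 1 / (1 + κ * a) ^ m) * (1 - 1 / (1 + κ * b) ^ m))
  rw [Nat.sub_add_cancel hm] at h
  refine (congrArg₂ HasSum ?_ ?_).mpr h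
  · funext k
    rcases Nat.eq_zero_or_pos k with rfl | hk
    · simp [laplaceFactor]
    · rw [Function.update_of_ne hk.ne']
      simp only [laplaceFactor, hk.ne', if_false, hx]
      rw [div_pow, pow_add, pow_add]
      simp only [mul_pow]
      field_simp
  · have e : 1 / ((1 + κ * a) * (1 + κ * b)) ^ m * (1 / (1 - x) ^ m) =
        1 / ((1 + κ * a) * (1 + κ * b) - κ * a * (κ * b) * q) ^ m := by
      rw [div_mul_div_comm, one_mul, ← mul_pow, mul_sub, mul_one, hx,
        mul_div_cancel₀ _ (by positivity)]
    rw [e, mul_pow]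
    simp
    field_simp
    ring

/-! ### The mixed square-root moment of Kibble's law -/

section BivariateGamma

variable {ν : Measure (ℝ × ℝ)} [IsProbabilityMeasure ν]

/-- `ν` has the Laplace transform of Kibble's bivariate gamma distribution. -/
def IsKibble (ν : Measure (ℝ × ℝ)) (m : ℕ) (κ q : ℝ) : Prop :=
  ∀ a b : ℝ, 0 ≤ a → 0 ≤ b → ∫ p, Real.exp (-(p.1 * a)) * Real.exp (-(p.2 * b)) ∂ν =
    1 / ((1 + κ * a) * (1 + κ * b) - κ * a * (κ * b) * q) ^ m

lemma lintegral_one_sub_exp_mul_one_sub_exp {m : ℕ} (hm : 1 ≤ m) {κ q a b : ℝ} (hκ : 0 < κ)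
    (hq0 : 0 ≤ q) (hq1 : q ≤ 1) (hν : IsKibble ν m κ q) (h0 : ∀ᵐ p ∂ν, 0 ≤ p.1 ∧ 0 ≤ p.2)
    (ha : 0 ≤ a) (hb : 0 ≤ b) :
    ∫⁻ p, ENNReal.ofReal ((1 - Real.exp (-(p.1 * a))) * (1 - Real.exp (-(p.2 * b)))) ∂ν =
      ∑' k, ENNReal.ofReal (((k + (m - 1)).choose (m - 1) : ℝ) * q ^ k *
        (laplaceFactor m κ k a * laplaceFactor m κ k b)) := by
  have hint : ∀ a b : ℝ, 0 ≤ a → 0 ≤ b →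
      Integrable (fun p : ℝ × ℝ => Real.exp (-(p.1 * a)) * Real.exp (-(p.2 * b))) ν := by
    intro a b ha hb
    refine Integrable.of_bound (by fun_prop) 1 ?_
    filter_upwards [h0] with p hp
    rw [Real.norm_of_nonneg (by positivity), ← Real.exp_add, Real.exp_le_one_iff]
    have := mul_nonneg hp.1 ha
    have := mul_nonneg hp.2 hb
    linarith
  -- Setting one argument to zero gives the marginal transforms.
  have ia := hint a 0 ha le_rfl
  have ib := hint 0 b le_rfl hb
  have iab := hint a b ha hb
  have ea := hν a 0 ha le_rfl
  have eb := hν 0 b le_rfl hb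
  simp only [mul_zero, neg_zero, Real.exp_zero, mul_one, add_zero, zero_mul, sub_zero] at ia ea
  simp only [mul_zero, neg_zero, Real.exp_zero, one_mul, add_zero, zero_mul, sub_zero] at ib eb
  have e : ∀ p : ℝ × ℝ, (1 - Real.exp (-(p.1 * a))) * (1 - Real.exp (-(p.2 * b))) =
      1 - Real.exp (-(p.1 * a)) - Real.exp (-(p.2 * b)) +
        Real.exp (-(p.1 * a)) * Real.exp (-(p.2 * b)) := fun p => by ring
  have hs := hasSum_laplaceFactor_mul hm hκ hq0 hq1 ha hb
  have i1 : Integrable (fun p : ℝ × ℝ => 1 - Real.exp (-(p.1 * a))) ν :=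
    (integrable_const _).sub ia
  have i2 : Integrable (fun p : ℝ × ℝ => 1 - Real.exp (-(p.1 * a)) - Real.exp (-(p.2 * b))) ν :=
    i1.sub ib
  rw [← ENNReal.ofReal_tsum_of_nonneg _ hs.summable, hs.tsum_eq,
    ← ofReal_integral_eq_lintegral_ofReal]
  · simp_rw [e]
    rw [integral_add i2 iab, integral_sub i1 ib, integral_sub (integrable_const _) ia, ea, eb,
      hν a b ha hb]
    simp
  · simp_rw [e]
    exact i2.add iab
  · filter_upwards [h0] with p hp
    have h1 : Real.exp (-(p.1 * a)) ≤ 1 := by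
      rw [Real.exp_le_one_iff, neg_nonpos]; exact mul_nonneg hp.1 ha
    have h2 : Real.exp (-(p.2 * b)) ≤ 1 := by
      rw [Real.exp_le_one_iff, neg_nonpos]; exact mul_nonneg hp.2 hb
    exact mul_nonneg (by linarith) (by linarith)
  · intro k
    have := laplaceFactor_nonneg m hκ k ha
    have := laplaceFactor_nonneg m hκ k hb
    positivity

lemma lintegral_sqrt_mul_sqrt_of_isKibble {m : ℕ} (hm : 1 ≤ m) {κ q : ℝ} (hκ : 0 < κ)
    (hq0 : 0 ≤ q) (hq1 : q ≤ 1) (hν : IsKibble ν m κ q) (h0 : ∀ᵐ p ∂ν, 0 ≤ p.1 ∧ 0 ≤ p.2) :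
    ∫⁻ p, ENNReal.ofReal (2 * √Real.pi * √p.1) * ENNReal.ofReal (2 * √Real.pi * √p.2) ∂ν =
      ∑' k : ℕ, ENNReal.ofReal (((k + (m - 1)).choose (m - 1) : ℝ) * q ^ k *
        (√κ * |Real.Gamma (k - 1 / 2)| * Real.Gamma (m + 1 / 2) / Real.Gamma (m + k)) ^ 2) := by
  set μ : Measure ℝ := volume.restrict (Set.Ioi 0) with hμ
  calc _ = ∫⁻ p, ∫⁻ u, ENNReal.ofReal ((1 - Real.exp (-(p.1 * u.1))) * u.1 ^ (-(3 / 2) : ℝ)) *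
          ENNReal.ofReal ((1 - Real.exp (-(p.2 * u.2))) * u.2 ^ (-(3 / 2) : ℝ)) ∂(μ.prod μ) ∂ν := by
        refine lintegral_congr_ae ?_
        filter_upwards [h0] with p hp
        rw [lintegral_prod_mul
            (f := fun a => ENNReal.ofReal ((1 - Real.exp (-(p.1 * a))) * a ^ (-(3 / 2) : ℝ)))
            (g := fun a => ENNReal.ofReal ((1 - Real.exp (-(p.2 * a))) * a ^ (-(3 / 2) : ℝ)))
            (by fun_prop) (by fun_prop), lintegral_one_sub_exp_mul_rpow hp.1,
          lintegral_one_sub_exp_mul_rpow hp.2]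
    _ = ∫⁻ u, ∫⁻ p, ENNReal.ofReal ((1 - Real.exp (-(p.1 * u.1))) * u.1 ^ (-(3 / 2) : ℝ)) *
          ENNReal.ofReal ((1 - Real.exp (-(p.2 * u.2))) * u.2 ^ (-(3 / 2) : ℝ)) ∂ν ∂(μ.prod μ) :=
        lintegral_lintegral_swap (by fun_prop)
    _ = ∫⁻ u, ∑' k, ENNReal.ofReal (((k + (m - 1)).choose (m - 1) : ℝ) * q ^ k) *
          (ENNReal.ofReal (laplaceFactor m κ k u.1 * u.1 ^ (-(3 / 2) : ℝ)) *
            ENNReal.ofReal (laplaceFactor m κ k u.2 * u.2 ^ (-(3 / 2) : ℝ))) ∂(μ.prod μ) := by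
        rw [hμ, Measure.prod_restrict]
        refine setLIntegral_congr_fun (measurableSet_Ioi.prod measurableSet_Ioi) fun u hu => ?_
        have hu1 : 0 < u.1 := hu.1
        have hu2 : 0 < u.2 := hu.2
        have hc : 0 ≤ u.1 ^ (-(3 / 2) : ℝ) * u.2 ^ (-(3 / 2) : ℝ) := by positivity
        calc _ = ∫⁻ p, ENNReal.ofReal (u.1 ^ (-(3 / 2) : ℝ) * u.2 ^ (-(3 / 2) : ℝ)) *
              ENNReal.ofReal ((1 - Real.exp (-(p.1 * u.1))) * (1 - Real.exp (-(p.2 * u.2)))) ∂ν := by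
              refine lintegral_congr_ae ?_
              filter_upwards [h0] with p hp
              have h1 : Real.exp (-(p.1 * u.1)) ≤ 1 := by
                rw [Real.exp_le_one_iff, neg_nonpos]; exact mul_nonneg hp.1 hu1.le
              rw [← ENNReal.ofReal_mul (mul_nonneg (by linarith) (by positivity)),
                ← ENNReal.ofReal_mul hc]
              congr 1
              ring
          _ = _ := by
              rw [lintegral_const_mul _ (by fun_prop),
                lintegral_one_sub_exp_mul_one_sub_exp hm hκ hq0 hq1 hν h0 hu1.le hu2.le,
                ← ENNReal.tsum_mul_left]
              congr 1
              ext k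
              have := laplaceFactor_nonneg m hκ k hu1.le
              have := laplaceFactor_nonneg m hκ k hu2.le
              rw [← ENNReal.ofReal_mul hc, ← ENNReal.ofReal_mul (by positivity),
                ← ENNReal.ofReal_mul (by positivity)]
              congr 1
              ring
    _ = ∑' k : ℕ, ENNReal.ofReal (((k + (m - 1)).choose (m - 1) : ℝ) * q ^ k) *
          (ENNReal.ofReal (√κ * |Real.Gamma (k - 1 / 2)| * Real.Gamma (m + 1 / 2) /
              Real.Gamma (m + k)) *
            ENNReal.ofReal (√κ * |Real.Gamma (k - 1 / 2)| * Real.Gamma (m + 1 / 2) /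
              Real.Gamma (m + k))) := by
        have hmf : ∀ k, Measurable fun a : ℝ =>
            ENNReal.ofReal (laplaceFactor m κ k a * a ^ (-(3 / 2) : ℝ)) := fun k =>
          ((measurable_laplaceFactor m κ k).mul (by fun_prop)).ennreal_ofReal
        have hmp : ∀ k, Measurable fun u : ℝ × ℝ =>
            ENNReal.ofReal (laplaceFactor m κ k u.1 * u.1 ^ (-(3 / 2) : ℝ)) *
              ENNReal.ofReal (laplaceFactor m κ k u.2 * u.2 ^ (-(3 / 2) : ℝ)) := fun k =>
          ((hmf k).comp measurable_fst).mul ((hmf k).comp measurable_snd)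
        rw [lintegral_tsum fun k => ((hmp k).const_mul _).aemeasurable]
        congr 1
        ext k
        rw [lintegral_const_mul _ (hmp k), lintegral_prod_mul (hmf k).aemeasurable
          (hmf k).aemeasurable, hμ, lintegral_laplaceFactor_mul_rpow hm hκ]
    _ = _ := by
        congr 1
        ext k
        have hm' : (0 : ℝ) < m := by exact_mod_cast hm
        have g1 : 0 < Real.Gamma (m + 1 / 2) := Real.Gamma_pos_of_pos (by positivity)
        have g2 : 0 < Real.Gamma (m + k) := Real.Gamma_pos_of_pos (by positivity)
        rw [← ENNReal.ofReal_mul (by positivity), ← ENNReal.ofReal_mul (by positivity), sq]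

end BivariateGamma

/-- The binomial coefficient is (m)_k / k!, cancelling one of the two factors (m)_k from Γ(m+k)²;
Γ(k-1/2)² equals 4π times the square of (-1/2)_k. -/
lemma choose_mul_sq_eq_hypergeometric {m : ℕ} (hm : 1 ≤ m) {κ q : ℝ} (hκ : 0 < κ) (k : ℕ) :
    ((k + (m - 1)).choose (m - 1) : ℝ) * q ^ k *
        (√κ * |Real.Gamma (k - 1 / 2)| * Real.Gamma (m + 1 / 2) / Real.Gamma (m + k)) ^ 2 =
      4 * Real.pi * (κ * (Real.Gamma (m + 1 / 2) / Real.Gamma m) ^ 2) *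
        (((k.factorial : ℝ)⁻¹ * (ascPochhammer ℝ k).eval (-1 / 2 : ℝ) *
          (ascPochhammer ℝ k).eval (-1 / 2 : ℝ) * ((ascPochhammer ℝ k).eval (m : ℝ))⁻¹) • q ^ k) := by
  have hm' : (0 : ℝ) < m := by exact_mod_cast hm
  have g2 : 0 < Real.Gamma m := Real.Gamma_pos_of_pos hm'
  have g3 : 0 < (ascPochhammer ℝ k).eval (m : ℝ) := ascPochhammer_pos k _ hm'
  rw [div_pow, mul_pow, mul_pow, sq_abs, Real.sq_sqrt hκ.le, Gamma_natCast_sub_half,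
    Gamma_add_natCast_eq_ascPochhammer (fun j => by positivity), choose_eq_ascPochhammer_div hm,
    mul_pow, neg_sq, mul_pow 2, Real.sq_sqrt Real.pi_pos.le, smul_eq_mul]
  field_simp
  ring

lemma integral_sqrt_mul_sqrt_of_isKibble {ν : Measure (ℝ × ℝ)} [IsProbabilityMeasure ν] {m : ℕ}
    (hm : 1 ≤ m) {κ q : ℝ} (hκ : 0 < κ) (hq0 : 0 ≤ q) (hq1 : q ≤ 1) (hν : IsKibble ν m κ q)
    (h0 : ∀ᵐ p ∂ν, 0 ≤ p.1 ∧ 0 ≤ p.2) :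
    ∫ p, √p.1 * √p.2 ∂ν = κ * (Real.Gamma (m + 1 / 2) / Real.Gamma m) ^ 2 *
      ordinaryHypergeometric (-1 / 2 : ℝ) (-1 / 2) (m : ℝ) q := by
  have hpi := Real.pi_pos
  have h : ∫ p : ℝ × ℝ, 4 * Real.pi * (√p.1 * √p.2) ∂ν = 4 * Real.pi *
      (κ * (Real.Gamma (m + 1 / 2) / Real.Gamma m) ^ 2 *
        ordinaryHypergeometric (-1 / 2 : ℝ) (-1 / 2) (m : ℝ) q) := by
    rw [integral_eq_lintegral_of_nonneg_ae (ae_of_all _ fun p => by positivity) (by fun_prop)]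
    have e : ∀ p : ℝ × ℝ, ENNReal.ofReal (4 * Real.pi * (√p.1 * √p.2)) =
        ENNReal.ofReal (2 * √Real.pi * √p.1) * ENNReal.ofReal (2 * √Real.pi * √p.2) := by
      intro p
      rw [← ENNReal.ofReal_mul (by positivity)]
      congr 1
      linear_combination (-4 * √p.1 * √p.2) * Real.sq_sqrt hpi.le
    simp_rw [e]
    -- Finiteness of each term suffices here: for a divergent series both sides would be 0 by
    -- convention.
    rw [lintegral_sqrt_mul_sqrt_of_isKibble hm hκ hq0 hq1 hν h0,
      ENNReal.tsum_toReal_eq fun k => ENNReal.ofReal_ne_top, ordinaryHypergeometric_eq_tsum,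
      ← mul_assoc, ← tsum_mul_left]
    congr 1
    ext k
    rw [ENNReal.toReal_ofReal (by positivity), choose_mul_sq_eq_hypergeometric hm hκ]
  rw [integral_const_mul] at h
  exact mul_left_cancel₀ (by positivity) h

/-! ### Application to the Gaussian family -/

section GaussianFamily

variable {S : Type*} [MeasurableSpace S] {P : Measure S} {m : ℕ} {Ω : ℝ} {ρ : ℝ → ℝ}
  {X : Fin (2 * m) → ℝ → S → ℝ}

lemma IsGaussianFamily.sq_correlation_le_one [IsProbabilityMeasure P]
    (hX : IsGaussianFamily P m Ω ρ X) (hm : 1 ≤ m) (hΩ : 0 < Ω) (τ : ℝ) : ρ τ ^ 2 ≤ 1 := by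
  have hm' : (0 : ℝ) < m := by exact_mod_cast hm
  have hv : ((Ω / (2 * m)).toNNReal : ℝ) = Ω / (2 * m) := Real.coe_toNNReal _ (by positivity)
  let p : Fin (2 * m) := ⟨0, by omega⟩
  have h := (variance_sub_mul_of_correlation (hX.gaussian p).hasGaussianLaw_prodMk (hX.law p 0)
    (hX.law p (0 + τ)) (by rw [hv]; exact hX.correlation p 0 τ)).2
  have h2 := variance_nonneg (fun ω => X p (0 + τ) ω - ρ τ * X p 0 ω) P
  rw [h, hv] at h2
  have := nonneg_of_mul_nonneg_right h2 (by positivity)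
  linarith

lemma IsGaussianFamily.isKibble [IsProbabilityMeasure P]
    (hX : IsGaussianFamily P m Ω ρ X) (hm : 1 ≤ m) (hΩ : 0 < Ω) (t τ : ℝ) :
    IsKibble (P.map fun ω => (∑ p, X p t ω ^ 2, ∑ p, X p (t + τ) ω ^ 2)) m (Ω / m) (ρ τ ^ 2) := by
  intro a b ha hb
  have hm' : (0 : ℝ) < m := by exact_mod_cast hm
  have hv : ((Ω / (2 * m)).toNNReal : ℝ) = Ω / (2 * m) := Real.coe_toNNReal _ (by positivity)
  have hX' : ∀ p t, AEMeasurable (X p t) P := fun p t => (hX.law p t).aemeasurable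
  have hi : iIndepFun (fun p ω => (X p t ω, X p (t + τ) ω)) P :=
    hX.indep.comp (fun _ x => (x t, x (t + τ))) fun _ => by fun_prop
  have hg : ∀ p : Fin (2 * m), AEStronglyMeasurable
      (fun x : ℝ × ℝ => Real.exp (-a * x.1 ^ 2) * Real.exp (-b * x.2 ^ 2))
      (P.map fun ω => (X p t ω, X p (t + τ) ω)) := fun p =>
    Measurable.aestronglyMeasurable (by fun_prop)
  have h := hi.integral_fun_prod_comp (fun p => (hX' p t).prodMk (hX' p (t + τ))) hg
  have hone : ∀ p, ∫ ω, Real.exp (-a * X p t ω ^ 2) * Real.exp (-b * X p (t + τ) ω ^ 2) ∂P = _ :=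
    fun p => integral_exp_neg_mul_sq_of_hasGaussianLaw (hX.gaussian p).hasGaussianLaw_prodMk
      (hX.law p t) (hX.law p (t + τ)) (by rw [hv]; exact hX.correlation p t τ)
      (hX.sq_correlation_le_one hm hΩ τ) ha hb
  simp only [hone, Finset.prod_const, Finset.card_univ, Fintype.card_fin] at h
  rw [integral_map (by fun_prop) (Measurable.aestronglyMeasurable (by fun_prop))]
  have e : ∀ ω, Real.exp (-((∑ p, X p t ω ^ 2) * a)) *
      Real.exp (-((∑ p, X p (t + τ) ω ^ 2) * b)) =
      ∏ p, Real.exp (-a * X p t ω ^ 2) * Real.exp (-b * X p (t + τ) ω ^ 2) := by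
    intro ω
    rw [Finset.prod_mul_distrib, ← Real.exp_sum, ← Real.exp_sum, ← Finset.mul_sum,
      ← Finset.mul_sum]
    ring_nf
  simp only [e]
  have hq := hX.sq_correlation_le_one hm hΩ τ
  have hκa : 0 ≤ Ω / m * a := by positivity
  have hκb : 0 ≤ Ω / m * b := by positivity
  have eD : (1 + 2 * a * (Ω / (2 * m))) * (1 + 2 * b * (Ω / (2 * m))) -
      4 * a * b * (Ω / (2 * m)) ^ 2 * ρ τ ^ 2 =
      (1 + Ω / m * a) * (1 + Ω / m * b) - Ω / m * a * (Ω / m * b) * ρ τ ^ 2 := by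
    field_simp
    ring
  have hD : 0 ≤ (1 + Ω / m * a) * (1 + Ω / m * b) - Ω / m * a * (Ω / m * b) * ρ τ ^ 2 := by
    nlinarith [mul_le_of_le_one_right (mul_nonneg hκa hκb) hq]
  -- Each of the 2m pairs contributes the power -1/2, giving -m in total.
  rw [h, hv, eD, pow_mul, inv_pow, Real.sq_sqrt hD, inv_pow, one_div]

/-- Square integrability gives integrability of Z(t)Z(t+τ) by Hölder. -/
lemma IsGaussianFamily.memLp_two_rootSumSq (hX : IsGaussianFamily P m Ω ρ X) (t : ℝ) :
    MemLp (rootSumSq X t) 2 P := by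
  have hX' : ∀ p, MemLp (X p t) 2 P := fun p => ((hX.gaussian p).hasGaussianLaw_eval t).memLp_two
  have hmeas : AEMeasurable (rootSumSq X t) P := by
    have : ∀ p, AEMeasurable (X p t) P := fun p => (hX' p).aemeasurable
    unfold rootSumSq
    fun_prop
  rw [memLp_two_iff_integrable_sq hmeas.aestronglyMeasurable]
  have e : ∀ ω, rootSumSq X t ω ^ 2 = ∑ p, X p t ω ^ 2 := fun ω =>
    Real.sq_sqrt (by positivity)
  simp_rw [e]
  exact integrable_finsetSum _ fun p _ => (hX' p).integrable_sq

lemma IsGaussianFamily.autocorrelation_rootSumSq [IsProbabilityMeasure P]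
    (hX : IsGaussianFamily P m Ω ρ X) (hm : 1 ≤ m) (hΩ : 0 < Ω) (t τ : ℝ) :
    autocorrelation P (rootSumSq X) t τ = Ω * nakagamiCorrelation m (ρ τ) := by
  have hm' : (0 : ℝ) < m := by exact_mod_cast hm
  have hX' : ∀ p t, AEMeasurable (X p t) P := fun p t => (hX.law p t).aemeasurable
  have hmap : AEMeasurable (fun ω => (∑ p, X p t ω ^ 2, ∑ p, X p (t + τ) ω ^ 2)) P := by fun_prop
  have := Measure.isProbabilityMeasure_map hmap
  have h := integral_sqrt_mul_sqrt_of_isKibble hm (by positivity) (sq_nonneg _)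
    (hX.sq_correlation_le_one hm hΩ τ) (hX.isKibble hm hΩ t τ) (by
      rw [ae_map_iff hmap (by measurability)]
      exact ae_of_all _ fun ω => ⟨by positivity, by positivity⟩)
  rw [integral_map hmap (Measurable.aestronglyMeasurable (by fun_prop))] at h
  rw [autocorrelation, nakagamiCorrelation]
  refine h.trans ?_
  ring

end GaussianFamily

theorem mainTheorem3 {S : Type*} [MeasurableSpace S] (P : Measure S) [IsProbabilityMeasure P]
    (m : ℕ) (hm : 1 ≤ m) (Ω : ℝ) (hΩ : 0 < Ω) (ρ : ℝ → ℝ)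
    (X : Fin (2 * m) → ℝ → S → ℝ) (hX : IsGaussianFamily P m Ω ρ X) :
    (∀ t, HasLaw (rootSumSq X t) (nakagamiMeasure m Ω) P) ∧
    (∀ t τ, Integrable (fun ω => rootSumSq X t ω * rootSumSq X (t + τ) ω) P ∧
      autocorrelation P (rootSumSq X) t τ = Ω * nakagamiCorrelation m (ρ τ)) ∧
    (∀ f : ℝ, ρ = jakesCorrelation f → ∀ t τ,
      autocorrelation P (rootSumSq X) t τ = Ω * nakagamiCorrelation m (jakesCorrelation f τ)) := by
  refine ⟨hasLaw_rootSumSq hm hΩ hX, fun t τ => ⟨?_, hX.autocorrelation_rootSumSq hm hΩ t τ⟩, ?_⟩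
  · exact (hX.memLp_two_rootSumSq t).integrable_mul (hX.memLp_two_rootSumSq (t + τ))
  · rintro f rfl t τ
    exact hX.autocorrelation_rootSumSq hm hΩ t τ
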